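/- All graphs are finite, simple and undirected. For a graph $G=(V,E)$ and an integer $r\ge 0$, a set $D\subseteq V$ is a distance-$r$ dominating set if every vertex of $G$ is at distance at most $r$ from some vertex of $D$. An $r$-shallow minor of $G$ is a graph obtained by taking a subgraph $S$ of $G$, partitioning $V(S)$ into parts that induce connected subgraphs of $S$ of radius at most $r$, and contracting each part to a single vertex (removing loops and parallel edges); $\nabla_r(G)$ is the maximum edge density $|E(H)|/|V(H)|$ over all $r$-shallow minors $H$ of $G$. A graph class $\mathcal C$ has bounded expansion with expansion function $f:\mathbb N\to\mathbb N$ if $\nabla_s(G)\le f(s)$ for all $G\in\mathcal C$ and all $s\in\mathbb N$. The girth of a graph is the length of its shortest cycle ($\infty$ for forests). In the CONGEST model the vertices of an $n$-vertex graph $G$ are processors with distinct identifiers of $O(\log n)$ bits. Initially a vertex knows only its own identifier and those of its neighbours. In each synchronous round every vertex sends a message of $O(\log n)$ bits to each of its neighbours, receives the messages of its neighbours, performs arbitrary local computation, and may halt with an output. **Theorem.** There are deterministic CONGEST algorithms $A_r$ ($r\in\mathbb N$) and absolute constants $c,C$ such that the following holds for every $r\in\mathbb N$ and every graph class $\mathcal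 C$ of bounded expansion with expansion function $f$ in which every graph has girth at least $4r+3$. On every $G\in\mathcal C$, with any assignment of distinct identifiers of $O(\log n)$ bits, all vertices halt under $A_r$ within $c\cdot r$ rounds, all messages have $O(\log n)$ bits (where the implied constant depends only on the one for the identifiers), and the set $D$ of vertices that output "yes" is a distance-$r$ dominating set of $G$ with $$|D|\le \bigl(1+C\cdot r\cdot f(r)\bigr)\cdot |M|$$ for every minimum distance-$r$ dominating set $M$ of $G$. In particular, $A_r$ runs in $O(r)$ rounds and is an $O(r\cdot f(r))$-approximation whenever $r\cdot f(r)\ge 1$. -/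

import Mathlib

open scoped ENNReal

universe u

/-! ### Distance-`r` domination -/

/-- `D` is a distance-`r` dominating set of `G`: every vertex is at distance at most `r` from some
vertex of `D`. The distance `SimpleGraph.edist` is `⊤` between different components. -/
def IsDistDominating {V : Type u} (G : SimpleGraph V) (r : ℕ) (D : Finset V) : Prop :=
  ∀ v : V, ∃ d ∈ D, G.edist d v ≤ (r : ℕ∞)

/-- `D` is a distance-`r` dominating set whose size is at most `α` times the size of every
(in particular, of a minimum) distance-`r` dominating set. -/
def IsDistDominatingApprox {V : Type u} (G : SimpleGraph V) (r α : ℕ) (D : Finset V) : Prop :=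
  IsDistDominating G r D ∧ ∀ M : Finset V, IsDistDominating G r M → D.card ≤ α * M.card

/-! ### Shallow minors and expansion -/

/-- `H` is an `r`-shallow minor of `G`: there are a subgraph `S` of `G` and a partition of the
vertices of `S` (the fibres of `π`), each part inducing a connected subgraph of `S` of radius at
most `r`, such that `H` arises from `S` by contracting every part to a single vertex (loops and
parallel edges are removed). A part is never empty, as a connected graph has a vertex. -/
def IsShallowMinor {V : Type u} {W : Type*} (r : ℕ) (H : SimpleGraph W) (G : SimpleGraph V) :
    Prop :=
  ∃ (S : G.Subgraph) (π : S.verts → W),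
    (∀ w : W, (S.coe.induce {x | π x = w}).Connected ∧
      (S.coe.induce {x | π x = w}).radius ≤ (r : ℕ∞)) ∧
    ∀ w w' : W, H.Adj w w' ↔ w ≠ w' ∧ ∃ x y : S.verts, π x = w ∧ π y = w' ∧ S.coe.Adj x y

/-- The edge density `|E| / |V|` of a graph on `t` vertices (`0` if `t = 0`). -/
noncomputable def edgeDensity {t : ℕ} (H : SimpleGraph (Fin t)) : ℝ≥0∞ :=
  (H.edgeSet.ncard : ℝ≥0∞) / (t : ℝ≥0∞)

/-- `∇_r(G)`: the largest edge density of an `r`-shallow minor of `G`. Up to isomorphism the minors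
of a finite graph are graphs on `Fin t`. -/
noncomputable def nabla {V : Type u} (r : ℕ) (G : SimpleGraph V) : ℝ≥0∞ :=
  ⨆ (t : ℕ) (H : SimpleGraph (Fin t)) (_ : IsShallowMinor r H G), edgeDensity H

/-- A class of graphs; only its finite members are ever considered. -/
abbrev GraphClass := ∀ V : Type u, SimpleGraph V → Prop

/-- The class `C` has bounded expansion with expansion function `f`. -/
def GraphClass.HasExpansion (C : GraphClass.{u}) (f : ℕ → ℕ) : Prop :=
  ∀ (V : Type u) [Fintype V] (G : SimpleGraph V), C V G → ∀ s : ℕ, nabla s G ≤ (f s : ℝ≥0∞)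

/-- Every graph in the class `C` has girth at least `g` (forests have girth `⊤`). -/
def GraphClass.GirthAtLeast (C : GraphClass.{u}) (g : ℕ) : Prop :=
  ∀ (V : Type u) [Fintype V] (G : SimpleGraph V), C V G → (g : ℕ∞) ≤ G.egirth

/-! ### Synchronous message passing -/

/-- A deterministic distributed algorithm with a yes/no output at each vertex. Local computation
is arbitrary. A vertex starts with its own identifier and the identifiers of its neighbours, and
does not know the number of vertices. -/
structure DistributedAlgorithm where
  /-- the local memory of a vertex -/
  State : Type
  /-- initial state, from the own identifier and the set of the neighbours' identifiers -/
  init : ℕ → Finset ℕ → State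
  /-- the bit string sent to the neighbour with the given identifier -/
  send : State → ℕ → List Bool
  /-- the new state, from the set of pairs (identifier of a neighbour, message received from it) -/
  receive : State → Finset (ℕ × List Bool) → State
  /-- `some b` if the vertex has halted with output `b`, and `none` if it is still running -/
  output : State → Option Bool

namespace DistributedAlgorithm

variable (A : DistributedAlgorithm) {V : Type u} [Fintype V] (G : SimpleGraph V) (ident : V → ℕ)

/-- The message that a vertex in state `s` passes to the neighbour with identifier `i`; a vertex
that has halted only passes empty messages. -/
def outgoing (s : A.State) (i : ℕ) : List Bool :=
  if (A.output s).isSome then [] else A.send s i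

open Classical in
/-- The state of every vertex after `t` synchronous rounds on the network `G` with identifiers
`ident`. A vertex that has halted keeps its state. -/
noncomputable def state : ℕ → V → A.State
  | 0, v => A.init (ident v) ((Finset.univ.filter (fun u => G.Adj v u)).image ident)
  | t + 1, v =>
    if (A.output (state t v)).isSome then state t v
    else A.receive (state t v)
      ((Finset.univ.filter (fun u => G.Adj v u)).image
        (fun u => (ident u, A.outgoing (state t u) (ident v))))

/-- Every vertex has halted after at most `T` rounds. -/
def HaltsWithin (T : ℕ) : Prop :=
  ∀ v : V, (A.output (A.state G ident T v)).isSome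

/-- Every message ever sent along an edge has at most `B` bits. -/
def MessagesBoundedBy (B : ℕ) : Prop :=
  ∀ (t : ℕ) (u v : V), G.Adj u v → (A.outgoing (A.state G ident t u) (ident v)).length ≤ B

open Classical in
/-- The set of vertices that have halted with output "yes" after `T` rounds. -/
noncomputable def outputSet (T : ℕ) : Finset V :=
  Finset.univ.filter (fun v => A.output (A.state G ident T v) = some true)

end DistributedAlgorithm

/-- `ident` is an assignment of distinct identifiers of at most `a * (⌊log₂ n⌋ + 1)` bits, where
`n` is the number of vertices. -/
def IsIdentifierAssignment {V : Type u} [Fintype V] (a : ℕ) (ident : V → ℕ) : Prop :=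
  Function.Injective ident ∧ ∀ v : V, ident v < 2 ^ (a * (Nat.log 2 (Fintype.card V) + 1))

/-!
Prune leaves for `r` steps, sparing one end of every isolated edge. Each step increases the distance
to the surviving set by at most one, so the survivors form a distance-`r` dominating set.

For the size, let `M` be any distance-`r` dominating set and split the graph into trees of depth at
most `r` rooted at the vertices of `M`. Because of the girth, a tree spans no further edge and two
trees are joined by at most one edge, so at most `2 · ∇_r(G) · |M|` vertex-edge incidences belong to
edges between trees. A subtree that meets no such edge is pruned away within `r` steps, unless it
shrinks to an isolated vertex, and pruning leaves exactly one vertex of a component in which that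
happens. Hence, apart from one vertex for each tree, every survivor is one of the `r` lowest
ancestors of an end of an edge between trees.
-/

/-! ### Leaf pruning -/

section Pruning

variable {V : Type u} (G : SimpleGraph V)

open Classical in
/-- The neighbours of `v` in the vertex set `A`. -/
noncomputable def neighborsIn (A : Finset V) (v : V) : Finset V :=
  A.filter fun u => G.Adj v u

variable {ι : Type*} [LinearOrder ι] (ident : V → ι)

open Classical in
/-- One step of leaf pruning: the leaves of the subgraph induced by `A` are removed, but when two
leaves are adjacent, only the one with the smaller identifier is. -/
noncomputable def prune (A : Finset V) : Finset V :=
  A.filter fun v => (neighborsIn G A v).card = 1 →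
    ∃ u ∈ neighborsIn G A v, ident u < ident v ∧ (neighborsIn G A u).card = 1

/-- The vertices that survive `t` steps of leaf pruning. -/
noncomputable def survivors [Fintype V] (t : ℕ) : Finset V :=
  (prune G ident)^[t] Finset.univ

variable {G ident} {A B : Finset V} {u v w : V}

theorem mem_neighborsIn : u ∈ neighborsIn G A v ↔ u ∈ A ∧ G.Adj v u := by
  simp [neighborsIn]

theorem neighborsIn_subset_neighborsIn (h : A ⊆ B) : neighborsIn G A v ⊆ neighborsIn G B v := by
  classical exact Finset.filter_subset_filter _ h

theorem mem_prune : v ∈ prune G ident A ↔ v ∈ A ∧ ((neighborsIn G A v).card = 1 →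
    ∃ u ∈ neighborsIn G A v, ident u < ident v ∧ (neighborsIn G A u).card = 1) := by
  simp [prune]

theorem prune_subset : prune G ident A ⊆ A :=
  Finset.filter_subset _ _

theorem eq_of_mem_neighborsIn_of_card_eq_one (h : (neighborsIn G A v).card = 1)
    (hu : u ∈ neighborsIn G A v) (hw : w ∈ neighborsIn G A v) : u = w :=
  Finset.card_le_one.1 h.le u hu w hw

theorem exists_adj_mem_prune (hinj : Function.Injective ident) (hv : v ∈ A)
    (hv' : v ∉ prune G ident A) : ∃ u ∈ prune G ident A, G.Adj v u := by
  have hleaf : (neighborsIn G A v).card = 1 := by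
    by_contra h
    exact hv' (mem_prune.2 ⟨hv, fun h' => absurd h' h⟩)
  obtain ⟨u, hu⟩ := Finset.card_pos.1 (hleaf ▸ one_pos)
  obtain ⟨huA, hadj⟩ := mem_neighborsIn.1 hu
  refine ⟨u, mem_prune.2 ⟨huA, fun huleaf => ⟨v, mem_neighborsIn.2 ⟨hv, hadj.symm⟩, ?_, hleaf⟩⟩,
    hadj⟩
  refine lt_of_le_of_ne (not_lt.1 fun hlt => hv' ?_) (hinj.ne hadj.ne)
  exact mem_prune.2 ⟨hv, fun _ => ⟨u, hu, hlt, huleaf⟩⟩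

theorem neighborsIn_prune_eq_empty (hv : v ∈ prune G ident A)
    (hcard : (neighborsIn G A v).card ≤ 1) : neighborsIn G (prune G ident A) v = ∅ := by
  refine Finset.eq_empty_of_forall_notMem fun w hw => ?_
  obtain ⟨hw', hadj⟩ := mem_neighborsIn.1 hw
  have hwN : w ∈ neighborsIn G A v := neighborsIn_subset_neighborsIn prune_subset hw
  have hleaf : (neighborsIn G A v).card = 1 := le_antisymm hcard (Finset.card_pos.2 ⟨w, hwN⟩)
  have hvN : v ∈ neighborsIn G A w := mem_neighborsIn.2 ⟨prune_subset hv, hadj.symm⟩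
  obtain ⟨u, hu, huv, huleaf⟩ := (mem_prune.1 hv).2 hleaf
  obtain rfl := eq_of_mem_neighborsIn_of_card_eq_one hleaf hu hwN
  obtain ⟨x, hx, hxu, -⟩ := (mem_prune.1 hw').2 huleaf
  obtain rfl := eq_of_mem_neighborsIn_of_card_eq_one huleaf hx hvN
  exact lt_asymm huv hxu

theorem isDistDominating_prune (hinj : Function.Injective ident) {t : ℕ}
    (hA : IsDistDominating G t A) : IsDistDominating G (t + 1) (prune G ident A) := by
  intro v
  obtain ⟨d, hd, hdv⟩ := hA v
  by_cases hd' : d ∈ prune G ident A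
  · exact ⟨d, hd', hdv.trans (by exact_mod_cast t.le_succ)⟩
  obtain ⟨u, hu, hadj⟩ := exists_adj_mem_prune hinj hd hd'
  refine ⟨u, hu, ?_⟩
  calc G.edist u v ≤ G.edist u d + G.edist d v := SimpleGraph.edist_triangle
    _ ≤ 1 + t := add_le_add (SimpleGraph.edist_eq_one_iff_adj.2 hadj.symm).le hdv
    _ = ((t + 1 : ℕ) : ℕ∞) := by rw [add_comm, Nat.cast_succ]

/-- An inner vertex of a path inside `A` has two neighbours in `A`, so it is not a leaf. -/
theorem support_subset_prune {p : G.Walk v w} (hp : p.IsPath)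
    (hA : ∀ x ∈ p.support, x ∈ A) (hv : v ∈ prune G ident A) (hw : w ∈ prune G ident A) :
    ∀ x ∈ p.support, x ∈ prune G ident A := by
  intro x hx
  obtain ⟨i, rfl, hi⟩ := SimpleGraph.Walk.mem_support_iff_exists_getVert.1 hx
  rcases eq_or_ne i 0 with rfl | hi0
  · rwa [p.getVert_zero]
  rcases hi.eq_or_lt with rfl | hlt
  · rwa [p.getVert_length]
  have hsub : p.toSubgraph.neighborSet (p.getVert i) ⊆ neighborsIn G A (p.getVert i) := by
    intro y hy
    exact mem_neighborsIn.2 ⟨hA y (p.mem_verts_toSubgraph.1 (p.toSubgraph.edge_vert hy.symm)),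
      p.toSubgraph.adj_sub hy⟩
  have htwo : 2 ≤ (neighborsIn G A (p.getVert i)).card := by
    rw [← hp.ncard_neighborSet_toSubgraph_internal_eq_two hi0 hlt, ← Set.ncard_coe_finset]
    exact Set.ncard_le_ncard hsub
  exact mem_prune.2 ⟨hA _ hx, fun h => by omega⟩

variable [Fintype V] {t : ℕ}

theorem survivors_succ : survivors G ident (t + 1) = prune G ident (survivors G ident t) :=
  Function.iterate_succ_apply' _ _ _

theorem isDistDominating_survivors (hinj : Function.Injective ident) :
    IsDistDominating G t (survivors G ident t) := by
  induction t with
  | zero => exact fun v => ⟨v, Finset.mem_univ v, by simp⟩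
  | succ t ih => rw [survivors_succ]; exact isDistDominating_prune hinj ih

theorem support_subset_survivors {p : G.Walk v w} (hp : p.IsPath)
    (hv : v ∈ survivors G ident t) (hw : w ∈ survivors G ident t) :
    ∀ x ∈ p.support, x ∈ survivors G ident t := by
  induction t with
  | zero => exact fun x _ => Finset.mem_univ x
  | succ t ih =>
    rw [survivors_succ] at hv hw ⊢
    exact support_subset_prune hp (ih (prune_subset hv) (prune_subset hw)) hv hw

theorem eq_of_reachable_of_neighborsIn_survivors_eq_empty (hv : v ∈ survivors G ident t)
    (hiso : neighborsIn G (survivors G ident t) v = ∅) (hw : w ∈ survivors G ident t)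
    (hvw : G.Reachable v w) : v = w := by
  obtain ⟨p, hp⟩ := hvw.exists_isPath
  by_contra hne
  have hnil : ¬ p.Nil := SimpleGraph.Walk.not_nil_of_ne hne
  have hsnd : p.snd ∈ neighborsIn G (survivors G ident t) v := mem_neighborsIn.2
    ⟨support_subset_survivors hp hv hw _ (p.getVert_mem_support 1), p.adj_snd hnil⟩
  exact Finset.notMem_empty _ (hiso ▸ hsnd)

end Pruning

/-! ### Contractions -/

section Contraction

variable {V : Type u} {W : Type*} {F G : SimpleGraph V} {r k : ℕ}

theorem egirth_le_edist_add_one {x y : V} (hFG : F ≤ G) (hG : G.Adj x y) (hF : ¬ F.Adj x y) :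
    G.egirth ≤ F.edist x y + 1 := by
  classical
  rcases eq_or_ne (F.edist x y) ⊤ with htop | hne
  · simp [htop]
  obtain ⟨p, hp⟩ := SimpleGraph.exists_walk_of_edist_ne_top hne
  have hedge : s(y, x) ∉ (p.toPath.1.mapLe hFG).edges := by
    rw [SimpleGraph.Walk.edges_mapLe_eq_edges]
    exact fun he => hF (p.toPath.1.adj_of_mem_edges he).symm
  have hcycle := SimpleGraph.Path.cons_isCycle
    ⟨p.toPath.1.mapLe hFG, p.toPath.2.mapLe hFG⟩ hG.symm hedge
  calc G.egirth ≤ ((p.toPath.1.mapLe hFG).length + 1 : ℕ) := SimpleGraph.egirth_le_length hcycle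
    _ ≤ (p.length + 1 : ℕ) := by
      rw [SimpleGraph.Walk.length_mapLe]
      exact_mod_cast Nat.succ_le_succ p.length_bypass_le_length
    _ = F.edist x y + 1 := by rw [Nat.cast_succ, hp]

theorem eq_of_reachable_of_adj_imp_eq {π : V → W} (hπ : ∀ ⦃x y⦄, F.Adj x y → π x = π y)
    {x y : V} (h : F.Reachable x y) : π x = π y := by
  obtain ⟨p⟩ := h
  induction p with
  | nil => rfl
  | cons hadj _ ih => exact (hπ hadj).trans ih

/-- `G.map π` is the contraction of the fibres of `π`, without loops and parallel edges. -/
theorem isShallowMinor_map {π : V → W} (hFG : F ≤ G) (hπ : ∀ ⦃x y⦄, F.Adj x y → π x = π y)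
    (hr : ∀ w, ∃ c, π c = w ∧ ∀ v, π v = w → F.edist c v ≤ r) :
    IsShallowMinor r (G.map π) G := by
  classical
  refine ⟨⊤, fun x => π x, fun w => ?_, fun w w' => ?_⟩
  · obtain ⟨c, hc, hcr⟩ := hr w
    let H : SimpleGraph {x : (⊤ : G.Subgraph).verts | π x = w} := (⊤ : G.Subgraph).coe.induce _
    let φ : F.induce {v | π v = w} →g H := ⟨fun x => ⟨⟨x, trivial⟩, x.2⟩, fun h => hFG h⟩
    have hdist (v : {x : (⊤ : G.Subgraph).verts | π x = w}) :
        H.edist ⟨⟨c, trivial⟩, hc⟩ v ≤ r := by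
      obtain ⟨p, hp⟩ := SimpleGraph.exists_walk_of_edist_ne_top
        (ne_top_of_le_ne_top (ENat.natCast_ne_top r) (hcr v v.2))
      have hsupp : ∀ x ∈ p.support, x ∈ {v | π v = w} := fun x hx =>
        (eq_of_reachable_of_adj_imp_eq hπ ⟨p.dropUntil x hx⟩).trans v.2
      calc H.edist ⟨⟨c, trivial⟩, hc⟩ v
          ≤ ((p.induce _ hsupp).map φ).length := SimpleGraph.edist_le _
        _ = p.length := by
          rw [SimpleGraph.Walk.length_map, ← SimpleGraph.Walk.length_map, p.map_induce hsupp]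
          rfl
        _ = F.edist c v := hp
        _ ≤ r := hcr v v.2
    have hconn : H.Connected := (SimpleGraph.connected_iff_exists_forall_reachable H).2
      ⟨⟨⟨c, trivial⟩, hc⟩, fun v => SimpleGraph.reachable_of_edist_ne_top
        (ne_top_of_le_ne_top (ENat.natCast_ne_top r) (hdist v))⟩
    exact ⟨hconn, SimpleGraph.radius_le_eccent.trans (iSup_le hdist)⟩
  · simp [SimpleGraph.map_adj', and_comm, and_assoc]

theorem IsShallowMinor.of_iso {W' : Type*} {H : SimpleGraph W} {H' : SimpleGraph W'}
    (h : IsShallowMinor r H G) (e : H ≃g H') : IsShallowMinor r H' G := by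
  obtain ⟨S, π, hpart, hadj⟩ := h
  refine ⟨S, e ∘ π, fun w => ?_, fun w w' => ?_⟩
  · have hfiber : {x | (e ∘ π) x = w} = {x | π x = e.symm w} :=
      Set.ext fun x => e.toEquiv.eq_symm_apply.symm
    rw [hfiber]
    exact hpart (e.symm w)
  · rw [← e.symm.map_adj_iff, hadj, e.symm.injective.ne_iff]
    simp only [Function.comp_apply, RelIso.eq_symm_apply]

theorem IsShallowMinor.edgeDensity_le_nabla {t : ℕ} {H : SimpleGraph (Fin t)}
    (h : IsShallowMinor r H G) : edgeDensity H ≤ nabla r G :=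
  le_iSup_of_le t (le_iSup₂ (f := fun H (_ : IsShallowMinor r H G) => edgeDensity H) H h)

theorem ncard_edgeSet_le_of_edgeDensity_le {t : ℕ} {H : SimpleGraph (Fin t)}
    (h : edgeDensity H ≤ k) : H.edgeSet.ncard ≤ k * t := by
  rcases t.eq_zero_or_pos with rfl | ht
  · simp [Subsingleton.elim H ⊥]
  · rw [edgeDensity, ENNReal.div_le_iff (by exact_mod_cast ht.ne') (ENNReal.natCast_ne_top t)] at h
    exact_mod_cast h

theorem IsShallowMinor.ncard_edgeSet_le [Fintype W] {H : SimpleGraph W}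
    (h : IsShallowMinor r H G) (hk : nabla r G ≤ k) :
    H.edgeSet.ncard ≤ k * Fintype.card W := by
  let e : H ≃g H.map (Fintype.equivFin W) := SimpleGraph.Iso.map (Fintype.equivFin W) H
  calc H.edgeSet.ncard = (H.map (Fintype.equivFin W)).edgeSet.ncard := Nat.card_congr e.mapEdgeSet
    _ ≤ k * Fintype.card W :=
      ncard_edgeSet_le_of_edgeDensity_le ((h.of_iso e).edgeDensity_le_nabla.trans hk)

open Classical in
/-- The darts (edges with an orientation) of `G` that join different fibres of `π`. -/
noncomputable def crossDarts [Fintype V] (G : SimpleGraph V) (π : V → W) : Finset G.Dart :=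
  Finset.univ.filter fun d => π d.fst ≠ π d.snd

theorem mem_crossDarts [Fintype V] {π : V → W} {d : G.Dart} :
    d ∈ crossDarts G π ↔ π d.fst ≠ π d.snd := by
  simp [crossDarts]

theorem card_crossDarts_le [Fintype V] [Finite W] {π : V → W}
    (huniq : ∀ d ∈ crossDarts G π, ∀ d' ∈ crossDarts G π,
      π d.fst = π d'.fst → π d.snd = π d'.snd → d = d') :
    (crossDarts G π).card ≤ 2 * (G.map π).edgeSet.ncard := by
  classical
  have := Fintype.ofFinite W
  let toDart (d : crossDarts G π) : (G.map π).Dart :=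
    ⟨(π d.1.fst, π d.1.snd), mem_crossDarts.1 d.2, _, _, d.1.adj, rfl, rfl⟩
  have hinj : Function.Injective toDart := fun d d' h => Subtype.ext <|
    huniq d d.2 d' d'.2 (congrArg (·.fst) h) (congrArg (·.snd) h)
  calc (crossDarts G π).card = Fintype.card (crossDarts G π) := (Fintype.card_coe _).symm
    _ ≤ Fintype.card (G.map π).Dart := Fintype.card_le_of_injective toDart hinj
    _ = 2 * (G.map π).edgeFinset.card := (G.map π).dart_card_eq_twice_card_edges
    _ = 2 * (G.map π).edgeSet.ncard := by
      rw [← SimpleGraph.coe_edgeFinset, Set.ncard_coe_finset]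

end Contraction

/-! ### Spanning forests -/

section Forest

variable {V : Type u} {G : SimpleGraph V} {r : ℕ} {M : Finset V}

/-- A spanning forest of `G` of depth at most `r` with root set `M`, encoded by the map that sends a
vertex to its parent and fixes the roots. -/
structure RootedForest (G : SimpleGraph V) (r : ℕ) (M : Finset V) where
  parent : V → V
  parent_of_mem : ∀ v ∈ M, parent v = v
  adj_parent : ∀ v, parent v ≠ v → G.Adj v (parent v)
  iterate_parent_mem : ∀ v, parent^[r] v ∈ M

theorem exists_adj_edist_add_one_le {m v : V} (hne : v ≠ m) (hreach : G.Reachable v m) :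
    ∃ u, G.Adj v u ∧ G.edist m u + 1 ≤ G.edist m v := by
  obtain ⟨p, hp⟩ := hreach.exists_walk_length_eq_edist
  cases p with
  | nil => exact absurd rfl hne
  | @cons _ u _ hadj q =>
    refine ⟨u, hadj, ?_⟩
    rw [SimpleGraph.edist_comm (v := v), ← hp, SimpleGraph.Walk.length_cons, Nat.cast_succ,
      SimpleGraph.edist_comm]
    exact add_le_add_left (SimpleGraph.edist_le q) 1

theorem exists_adj_of_notMem_of_isDistDominating (hM : IsDistDominating G r M) {v : V}
    (hv : v ∉ M) : ∃ u, G.Adj v u ∧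
      ∀ n : ℕ, (∃ m ∈ M, G.edist m v ≤ (n + 1 : ℕ)) → ∃ m ∈ M, G.edist m u ≤ n := by
  obtain ⟨d, hd, hdv⟩ := hM v
  obtain ⟨m, hm, hmin⟩ := M.exists_min_image (G.edist · v) ⟨d, hd⟩
  have hreach : G.Reachable m v := SimpleGraph.reachable_of_edist_ne_top
    (ne_top_of_le_ne_top (ENat.natCast_ne_top r) ((hmin d hd).trans hdv))
  obtain ⟨u, hadj, hu⟩ :=
    exists_adj_edist_add_one_le (ne_of_mem_of_not_mem hm hv).symm hreach.symm
  refine ⟨u, hadj, fun n ⟨m', hm', hn⟩ => ⟨m, hm, ?_⟩⟩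
  refine (ENat.add_le_add_iff_right ENat.one_ne_top).1 ?_
  exact hu.trans ((hmin m' hm').trans hn)

theorem IsDistDominating.nonempty_rootedForest (hM : IsDistDominating G r M) :
    Nonempty (RootedForest G r M) := by
  have hparent (v : V) : ∃ u, (v ∈ M → u = v) ∧ (u ≠ v → G.Adj v u) ∧
      ∀ n : ℕ, (∃ m ∈ M, G.edist m v ≤ (n + 1 : ℕ)) → ∃ m ∈ M, G.edist m u ≤ n := by
    by_cases hv : v ∈ M
    · exact ⟨v, fun _ => rfl, fun h => absurd rfl h, fun n _ => ⟨v, hv, by simp⟩⟩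
    · obtain ⟨u, hadj, hu⟩ := exists_adj_of_notMem_of_isDistDominating hM hv
      exact ⟨u, fun h => absurd h hv, fun _ => hadj, hu⟩
  choose parent hfix hadj hstep using hparent
  have hiter (n : ℕ) : ∀ v, (∃ m ∈ M, G.edist m v ≤ n) → parent^[n] v ∈ M := by
    induction n with
    | zero =>
      rintro v ⟨m, hm, hmv⟩
      obtain rfl := SimpleGraph.edist_eq_zero_iff.1 (nonpos_iff_eq_zero.1 hmv)
      exact hm
    | succ n ih => exact fun v hv => ih _ (hstep v n hv)
  exact ⟨⟨parent, hfix, hadj, fun v => hiter r v (hM v)⟩⟩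

namespace RootedForest

variable (P : RootedForest G r M)

/-- The root of the tree that contains `v`; its fibres are the trees of the forest. -/
def root (v : V) : M :=
  ⟨P.parent^[r] v, P.iterate_parent_mem v⟩

/-- The forest as a subgraph of `G`, with an edge from every vertex to its parent. -/
def forest : SimpleGraph V :=
  SimpleGraph.fromRel fun v u => P.parent v = u

variable {P} {k n i : ℕ} {v w x y x' y' : V}

theorem root_of_mem (hv : v ∈ M) : P.root v = ⟨v, hv⟩ :=
  Subtype.ext (Function.iterate_fixed (P.parent_of_mem v hv) r)

theorem root_parent : P.root (P.parent v) = P.root v := by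
  refine Subtype.ext ?_
  calc P.parent^[r] (P.parent v) = P.parent (P.parent^[r] v) := by
        rw [← Function.iterate_succ_apply, Function.iterate_succ_apply']
    _ = P.parent^[r] v := P.parent_of_mem _ (P.iterate_parent_mem v)

theorem iterate_parent_mem_of_le (hi : r ≤ i) : P.parent^[i] v ∈ M := by
  have hroot := P.iterate_parent_mem v
  rw [← Nat.sub_add_cancel hi, Function.iterate_add_apply,
    Function.iterate_fixed (P.parent_of_mem _ hroot)]
  exact hroot

theorem forest_adj : P.forest.Adj v w ↔ v ≠ w ∧ (P.parent v = w ∨ P.parent w = v) :=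
  SimpleGraph.fromRel_adj _ _ _

theorem forest_le : P.forest ≤ G := by
  intro v w h
  obtain ⟨hne, rfl | rfl⟩ := forest_adj.1 h
  · exact P.adj_parent v hne.symm
  · exact (P.adj_parent w hne).symm

theorem root_eq_of_forest_adj (h : P.forest.Adj v w) : P.root v = P.root w := by
  obtain ⟨-, rfl | rfl⟩ := forest_adj.1 h
  · exact root_parent.symm
  · exact root_parent

theorem edist_iterate_parent_le : P.forest.edist v (P.parent^[i] v) ≤ i := by
  induction i with
  | zero => simp
  | succ i ih =>
    have hstep : P.forest.edist (P.parent^[i] v) (P.parent^[i + 1] v) ≤ 1 := by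
      rw [Function.iterate_succ_apply', SimpleGraph.edist_le_one_iff_adj_or_eq, forest_adj]
      tauto
    calc P.forest.edist v (P.parent^[i + 1] v)
        ≤ P.forest.edist v (P.parent^[i] v) +
          P.forest.edist (P.parent^[i] v) (P.parent^[i + 1] v) := SimpleGraph.edist_triangle
      _ ≤ i + 1 := add_le_add ih hstep
      _ = ((i + 1 : ℕ) : ℕ∞) := (Nat.cast_succ i).symm

theorem edist_root_le : P.forest.edist (P.root v) v ≤ r :=
  SimpleGraph.edist_comm.trans_le edist_iterate_parent_le

theorem edist_le_of_root_eq (h : P.root v = P.root w) : P.forest.edist v w ≤ 2 * r :=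
  calc P.forest.edist v w ≤ P.forest.edist v (P.root v) + P.forest.edist (P.root v) w :=
        SimpleGraph.edist_triangle
    _ ≤ r + r := add_le_add edist_iterate_parent_le (h ▸ edist_root_le)
    _ = 2 * r := (two_mul _).symm

theorem reachable_of_root_eq (h : P.root v = P.root w) : G.Reachable v w :=
  (SimpleGraph.reachable_of_edist_ne_top (ne_top_of_le_ne_top (ENat.natCast_ne_top (2 * r))
    (by exact_mod_cast edist_le_of_root_eq h))).mono forest_le

theorem forest_adj_of_root_eq (hg : ((2 * r + 2 : ℕ) : ℕ∞) ≤ G.egirth) (hadj : G.Adj v w)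
    (hroot : P.root v = P.root w) : P.forest.Adj v w := by
  by_contra hforest
  have hle : ((2 * r + 2 : ℕ) : ℕ∞) ≤ ((2 * r + 1 : ℕ) : ℕ∞) :=
    calc ((2 * r + 2 : ℕ) : ℕ∞) ≤ P.forest.edist v w + 1 :=
          hg.trans (egirth_le_edist_add_one forest_le hadj hforest)
      _ ≤ 2 * r + 1 := add_le_add_left (edist_le_of_root_eq hroot) 1
      _ = ((2 * r + 1 : ℕ) : ℕ∞) := by push_cast; rfl
  exact absurd (Nat.cast_le.1 hle) (by omega)

theorem eq_and_eq_of_root_eq (hg : ((4 * r + 3 : ℕ) : ℕ∞) ≤ G.egirth) (hadj : G.Adj x y)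
    (hadj' : G.Adj x' y') (hx : P.root x = P.root x') (hy : P.root y = P.root y')
    (hxy : P.root x ≠ P.root y) : x = x' ∧ y = y' := by
  by_contra hne
  let F : SimpleGraph V := P.forest ⊔ SimpleGraph.edge x' y'
  have hFG : F ≤ G := sup_le forest_le ((SimpleGraph.edge_le_iff G).2 (Or.inr hadj'))
  have hF : ¬ F.Adj x y := by
    rw [SimpleGraph.sup_adj, SimpleGraph.edge_adj]
    rintro (h | ⟨h | ⟨rfl, rfl⟩, -⟩)
    · exact hxy (root_eq_of_forest_adj h)
    · exact hne h
    · exact hxy hy.symm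
  have hedge : F.edist x' y' ≤ 1 := SimpleGraph.edist_le_one_iff_adj_or_eq.2 <| Or.inl <|
    Or.inr <| (SimpleGraph.edge_adj _ _ _ _).2 ⟨Or.inl ⟨rfl, rfl⟩, hadj'.ne⟩
  have hle : ((4 * r + 3 : ℕ) : ℕ∞) ≤ ((4 * r + 2 : ℕ) : ℕ∞) :=
    calc ((4 * r + 3 : ℕ) : ℕ∞) ≤ F.edist x y + 1 :=
          hg.trans (egirth_le_edist_add_one hFG hadj hF)
      _ ≤ F.edist x x' + (F.edist x' y' + F.edist y' y) + 1 := by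
          gcongr
          exact SimpleGraph.edist_triangle.trans
            (add_le_add_right SimpleGraph.edist_triangle _)
      _ ≤ 2 * r + (1 + 2 * r) + 1 := by
          gcongr
          · exact (SimpleGraph.edist_anti le_sup_left).trans (edist_le_of_root_eq hx)
          · exact (SimpleGraph.edist_anti le_sup_left).trans (edist_le_of_root_eq hy.symm)
      _ = ((4 * r + 2 : ℕ) : ℕ∞) := by push_cast; ring
  exact absurd (Nat.cast_le.1 hle) (by omega)

theorem isShallowMinor_map_root : IsShallowMinor r (G.map P.root) G :=
  isShallowMinor_map forest_le (fun _ _ => root_eq_of_forest_adj)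
    fun m => ⟨m, root_of_mem m.2, fun _ hv => hv ▸ edist_root_le⟩

variable [Fintype V]

theorem card_crossDarts_root_le (hg : ((4 * r + 3 : ℕ) : ℕ∞) ≤ G.egirth) (hk : nabla r G ≤ k) :
    (crossDarts G P.root).card ≤ 2 * (k * M.card) := by
  have huniq : ∀ d ∈ crossDarts G P.root, ∀ d' ∈ crossDarts G P.root,
      P.root d.fst = P.root d'.fst → P.root d.snd = P.root d'.snd → d = d' := by
    intro d hd d' _ hfst hsnd
    obtain ⟨h₁, h₂⟩ :=
      eq_and_eq_of_root_eq hg d.adj d'.adj hfst hsnd (mem_crossDarts.1 hd)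
    exact SimpleGraph.Dart.ext _ _ (Prod.ext h₁ h₂)
  calc (crossDarts G P.root).card ≤ 2 * (G.map P.root).edgeSet.ncard := card_crossDarts_le huniq
    _ ≤ 2 * (k * M.card) := by
      rw [← Fintype.card_coe M]
      exact Nat.mul_le_mul_left 2 (isShallowMinor_map_root.ncard_edgeSet_le hk)

variable {ι : Type*} [LinearOrder ι] {ident : V → ι}

/-- By `hcross` and `hheight`, the subtree of `v` meets no edge between trees and has height less
than `n`. -/
theorem neighborsIn_survivors_eq_empty (hg : ((2 * r + 2 : ℕ) : ℕ∞) ≤ G.egirth)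
    (hcross : ∀ d ∈ crossDarts G P.root, ∀ i, P.parent^[i] d.fst ≠ v)
    (hheight : ∀ w, P.parent^[n] w ≠ v) (hv : v ∈ survivors G ident n) :
    neighborsIn G (survivors G ident n) v = ∅ := by
  induction n generalizing v with
  | zero => exact absurd rfl (hheight v)
  | succ n ih =>
    rw [survivors_succ] at hv ⊢
    have hchild (u : V) (hu : u ∈ survivors G ident n) (huv : P.parent u = v) : v = u := by
      by_contra hne
      have hisolated : neighborsIn G (survivors G ident n) u = ∅ := by
        refine ih (fun d hd i hi => hcross d hd (i + 1) ?_) (fun w hw => hheight w ?_) hu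
        · rw [Function.iterate_succ_apply', hi, huv]
        · rw [Function.iterate_succ_apply', hw, huv]
      have hadj : G.Adj u v := huv ▸ P.adj_parent u (huv ▸ hne)
      exact Finset.notMem_empty v (hisolated ▸ mem_neighborsIn.2 ⟨prune_subset hv, hadj⟩)
    have hparent : neighborsIn G (survivors G ident n) v ⊆ {P.parent v} := by
      intro u hu
      obtain ⟨hu, hadj⟩ := mem_neighborsIn.1 hu
      have hroot : P.root v = P.root u := by
        by_contra hne
        exact hcross ⟨(v, u), hadj⟩ (mem_crossDarts.2 hne) 0 rfl
      obtain ⟨hne, h | h⟩ := forest_adj.1 (forest_adj_of_root_eq hg hadj hroot)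
      · exact Finset.mem_singleton.2 h.symm
      · exact absurd (hchild u hu h) hne
    exact neighborsIn_prune_eq_empty hv (Finset.card_le_card hparent)

theorem exists_crossDart_of_mem_survivors (hg : ((2 * r + 2 : ℕ) : ℕ∞) ≤ G.egirth)
    (hv : v ∈ survivors G ident r) (hvM : v ∉ M)
    (hne : neighborsIn G (survivors G ident r) v ≠ ∅) :
    ∃ d ∈ crossDarts G P.root, ∃ i < r, P.parent^[i] d.fst = v := by
  by_contra! hcross
  refine hne (neighborsIn_survivors_eq_empty (P := P) hg (fun d hd i hi => ?_) (fun w hw => ?_) hv)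
  · rcases lt_or_ge i r with hir | hri
    · exact hcross d hd i hir hi
    · exact hvM (hi ▸ iterate_parent_mem_of_le hri)
  · exact hvM (hw ▸ P.iterate_parent_mem w)

theorem card_le_of_forall_mem_or_isolated (P : RootedForest G r M) {S : Finset V}
    (hS : S ⊆ survivors G ident n)
    (hiso : ∀ v ∈ S, v ∈ M ∨ neighborsIn G (survivors G ident n) v = ∅) : S.card ≤ M.card := by
  have hinj : Set.InjOn P.root S := by
    intro v hv w hw hroot
    have hvw : G.Reachable v w := reachable_of_root_eq hroot
    rcases hiso v hv with hvM | hv_iso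
    · rcases hiso w hw with hwM | hw_iso
      · rw [root_of_mem hvM, root_of_mem hwM] at hroot
        exact congrArg Subtype.val hroot
      · exact (eq_of_reachable_of_neighborsIn_survivors_eq_empty (hS hw) hw_iso (hS hv)
          hvw.symm).symm
    · exact eq_of_reachable_of_neighborsIn_survivors_eq_empty (hS hv) hv_iso (hS hw) hvw
  calc S.card ≤ (Finset.univ : Finset M).card :=
        Finset.card_le_card_of_injOn P.root (fun _ _ => Finset.mem_univ _) hinj
    _ = M.card := Fintype.card_coe M

theorem card_le_of_forall_exists_crossDart {S : Finset V}
    (hS : ∀ v ∈ S, ∃ d ∈ crossDarts G P.root, ∃ i < n, P.parent^[i] d.fst = v) :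
    S.card ≤ (crossDarts G P.root).card * n := by
  classical
  let T : Finset (G.Dart × ℕ) := crossDarts G P.root ×ˢ Finset.range n
  have hsub : S ⊆ T.image fun p => P.parent^[p.2] p.1.fst := by
    intro v hv
    obtain ⟨d, hd, i, hi, rfl⟩ := hS v hv
    exact Finset.mem_image.2 ⟨(d, i), Finset.mk_mem_product hd (Finset.mem_range.2 hi), rfl⟩
  calc S.card ≤ T.card := (Finset.card_le_card hsub).trans Finset.card_image_le
    _ = (crossDarts G P.root).card * n := by rw [Finset.card_product, Finset.card_range]

theorem card_survivors_le (P : RootedForest G r M) (hg : ((4 * r + 3 : ℕ) : ℕ∞) ≤ G.egirth)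
    (hk : nabla r G ≤ k) :
    (survivors G ident r).card ≤ (1 + 2 * (r * k)) * M.card := by
  classical
  let p (v : V) : Prop := v ∈ M ∨ neighborsIn G (survivors G ident r) v = ∅
  have hg' : ((2 * r + 2 : ℕ) : ℕ∞) ≤ G.egirth := le_trans (by norm_cast; omega) hg
  have hiso : ((survivors G ident r).filter p).card ≤ M.card :=
    P.card_le_of_forall_mem_or_isolated (Finset.filter_subset _ _)
      fun v hv => (Finset.mem_filter.1 hv).2
  have hcross : ((survivors G ident r).filter (¬ p ·)).card ≤ (crossDarts G P.root).card * r := by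
    refine card_le_of_forall_exists_crossDart fun v hv => ?_
    obtain ⟨hv, hpv⟩ := Finset.mem_filter.1 hv
    obtain ⟨hvM, hne⟩ := not_or.1 hpv
    exact exists_crossDart_of_mem_survivors hg' hv hvM hne
  calc (survivors G ident r).card
      = ((survivors G ident r).filter p).card + ((survivors G ident r).filter (¬ p ·)).card :=
        (Finset.card_filter_add_card_filter_not p).symm
    _ ≤ M.card + 2 * (k * M.card) * r :=
        add_le_add hiso (hcross.trans (Nat.mul_le_mul_right r (card_crossDarts_root_le hg hk)))
    _ = (1 + 2 * (r * k)) * M.card := by ring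

end RootedForest

end Forest

/-! ### Distributed leaf pruning -/

/-- The local memory of a vertex in distributed leaf pruning. -/
structure PruningState where
  /-- the number of rounds so far -/
  clock : ℕ
  id : ℕ
  /-- whether the vertex has survived so far -/
  alive : Bool
  /-- in the middle of a pruning step, the identifiers of the surviving neighbours -/
  nbrs : Finset ℕ

open Classical in
/-- Distributed leaf pruning: each of the `r` steps takes two rounds. In the first round every
vertex announces whether it is alive, in the second whether it has exactly one neighbour alive. -/
noncomputable def leafPruning (r : ℕ) : DistributedAlgorithm where
  State := PruningState
  init i _ := ⟨0, i, true, ∅⟩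
  send s _ := if Even s.clock then [s.alive] else [decide (s.nbrs.card = 1)]
  receive s R :=
    if Even s.clock then
      ⟨s.clock + 1, s.id, s.alive, (R.filter fun q => q.2 = [true]).image Prod.fst⟩
    else
      ⟨s.clock + 1, s.id, s.alive &&
        decide (s.nbrs.card = 1 → ∃ j ∈ s.nbrs, j < s.id ∧ (j, [true]) ∈ R), ∅⟩
  output s := if s.clock = 2 * r then some s.alive else none

section DistributedPruning

variable {V : Type u} [Fintype V] {G : SimpleGraph V} {ident : V → ℕ} {r t B B' : ℕ} {v : V}

theorem DistributedAlgorithm.MessagesBoundedBy.mono {A : DistributedAlgorithm}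
    (h : A.MessagesBoundedBy G ident B) (hB : B ≤ B') : A.MessagesBoundedBy G ident B' :=
  fun t u v huv => (h t u v huv).trans hB

open Classical in
theorem leafPruning_state_odd (ht : t < r)
    (h : ∀ v, (leafPruning r).state G ident (2 * t) v =
      (⟨2 * t, ident v, v ∈ survivors G ident t, ∅⟩ : PruningState)) :
    (leafPruning r).state G ident (2 * t + 1) v =
      (⟨2 * t + 1, ident v, v ∈ survivors G ident t,
        (neighborsIn G (survivors G ident t) v).image ident⟩ : PruningState) := by
  have hrunning : 2 * t ≠ 2 * r := by omega
  simp only [DistributedAlgorithm.state, DistributedAlgorithm.outgoing, h]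
  simp only [leafPruning, hrunning, if_false, Option.isSome_none, Bool.false_eq_true,
    even_two_mul, if_true, PruningState.mk.injEq, true_and, Finset.filter_image,
    Finset.image_image, Finset.filter_filter]
  congr 1
  ext u
  simp [mem_neighborsIn, and_comm]

open Classical in
theorem leafPruning_state_even (hinj : Function.Injective ident) (ht : t ≤ r) :
    (leafPruning r).state G ident (2 * t) v =
      (⟨2 * t, ident v, v ∈ survivors G ident t, ∅⟩ : PruningState) := by
  induction t generalizing v with
  | zero => simp [DistributedAlgorithm.state, leafPruning, survivors]
  | succ t ih =>
    have hodd (v : V) := leafPruning_state_odd (v := v) ht fun v => ih (t.le_succ.trans ht)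
    have hrunning : 2 * t + 1 ≠ 2 * r := by omega
    rw [show 2 * (t + 1) = 2 * t + 1 + 1 from rfl, DistributedAlgorithm.state]
    simp only [DistributedAlgorithm.outgoing, hodd]
    simp only [leafPruning, hrunning, if_false, Option.isSome_none, Bool.false_eq_true,
      Nat.not_even_two_mul_add_one, PruningState.mk.injEq, true_and, and_true,
      Finset.card_image_of_injective _ hinj]
    rw [← Bool.decide_and, decide_eq_decide, survivors_succ, mem_prune, Finset.exists_mem_image]
    refine and_congr_right' <| imp_congr_right fun _ => exists_congr fun u =>
      and_congr_right fun hu => and_congr_right' ?_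
    simp [hinj.eq_iff, (mem_neighborsIn.1 hu).2]

theorem leafPruning_haltsWithin (hinj : Function.Injective ident) :
    (leafPruning r).HaltsWithin G ident (2 * r) := by
  intro v
  rw [leafPruning_state_even hinj le_rfl]
  simp [leafPruning]

theorem leafPruning_outputSet (hinj : Function.Injective ident) :
    (leafPruning r).outputSet G ident (2 * r) = survivors G ident r := by
  ext v
  rw [DistributedAlgorithm.outputSet, Finset.mem_filter, leafPruning_state_even hinj le_rfl]
  simp [leafPruning]

theorem leafPruning_messagesBoundedBy : (leafPruning r).MessagesBoundedBy G ident 1 := by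
  intro t u v _
  simp only [DistributedAlgorithm.outgoing, leafPruning]
  split_ifs <;> simp

end DistributedPruning

theorem theorem1_general {V : Type u} [Fintype V] {G : SimpleGraph V} {r k : ℕ} {ident : V → ℕ}
    (hk : nabla r G ≤ k) (hg : ((4 * r + 3 : ℕ) : ℕ∞) ≤ G.egirth)
    (hinj : Function.Injective ident) :
    (leafPruning r).MessagesBoundedBy G ident 1 ∧
      (leafPruning r).HaltsWithin G ident (2 * r) ∧
      IsDistDominatingApprox G r (1 + 2 * (r * k))
        ((leafPruning r).outputSet G ident (2 * r)) := by
  rw [leafPruning_outputSet hinj]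
  refine ⟨leafPruning_messagesBoundedBy, leafPruning_haltsWithin hinj,
    isDistDominating_survivors hinj, fun M hM => ?_⟩
  obtain ⟨P⟩ := hM.nonempty_rootedForest
  exact P.card_survivors_le hg hk

/-- `A r` is the algorithm for distance parameter `r`: it, the constants `cRounds` and `cApprox`,
and the message constant `cBits a`, depend neither on the class, nor on its expansion function, nor
on the graph; the constants do not depend on `r` either. The constant `a` bounds the length of
the identifiers. -/
theorem theorem1 :
    ∃ (A : ℕ → DistributedAlgorithm) (cRounds cApprox : ℕ) (cBits : ℕ → ℕ),
      ∀ (r : ℕ) (f : ℕ → ℕ) (C : GraphClass.{u}),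
        C.HasExpansion f → C.GirthAtLeast (4 * r + 3) →
        ∀ (V : Type u) [Fintype V] (G : SimpleGraph V), C V G →
        ∀ (a : ℕ) (ident : V → ℕ), IsIdentifierAssignment a ident →
          (A r).MessagesBoundedBy G ident (cBits a * (Nat.log 2 (Fintype.card V) + 1)) ∧
          (A r).HaltsWithin G ident (cRounds * r) ∧
          IsDistDominatingApprox G r (1 + cApprox * (r * f r))
            ((A r).outputSet G ident (cRounds * r)) := by
  refine ⟨leafPruning, 2, 2, fun _ => 1, fun r f C hC hg V _ G hG a ident hid => ?_⟩
  obtain ⟨hmsg, hout⟩ := theorem1_general (hC V G hG r) (hg V G hG) hid.1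
  exact ⟨hmsg.mono (by simp), hout⟩
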